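/- Let $d,n\ge 0$ be integers and let $K_1,\dots,K_n$ be closed convex subsets of $\mathbb{R}^d$ (with the Euclidean norm) whose intersection $K=K_1\cap\dots\cap K_n$ is a convex body, i.e. a compact convex set with nonempty interior. For $\mu\subseteq\{1,\dots,n\}$ put $K_\mu=\bigcap_{i\in\mu}K_i$ (with $K_\emptyset=\mathbb{R}^d$). Then there is a set $\mu\subseteq\{1,\dots,n\}$ with at most $2d$ elements such that both $$\operatorname{vol}_d(K_\mu)\le (2d)^{3d}\operatorname{vol}_d(K)\qquad\text{and}\qquad \operatorname{diam}(K_\mu)\le (2d)^3\operatorname{diam}(K).$$ Here volume (Lebesgue measure) and diameter take values in $[0,\infty]$, so that in particular $K_\mu$ has finite volume and finite diameter; for $d=0$ we set $0^0=1$. -/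

import Mathlib

/-- A convex body in `ℝ^d`: a compact convex set with nonempty interior. -/
def IsConvexBodyWithInterior {d : ℕ} (K : Set (EuclideanSpace ℝ (Fin d))) : Prop :=
  Convex ℝ K ∧ IsCompact K ∧ (interior K).Nonempty

/-! Choose `z` inside the intersection, the centroid of a simplex of maximal volume, so that `A = K
- z` satisfies `A ⊆ -d A`. Put `z` at the origin and let `X` be the union of the polars of the
translated sets; it is compact and spanning. A basis `b` from `X` of maximal determinant gives every
`q ∈ X` coordinates in `[-1, 1]`. By the symmetry of `A`, a small negative multiple of `∑ b k` lies
in the polar of `A`, hence in the closed convex hull of `X`, and Carathéodory with the origin as a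
free vertex writes it with `d` points of `X`. These `2d` points select `μ`. They bound each `⟪b k,
p⟫` above and `⟪∑ b k, p⟫` below on the selected intersection, hence bound `⟪q, p⟫` below for all `q
∈ X`. By bipolarity that intersection lies in `-d(d+2) A`, and `d(d+2) ≤ (2d)^3`. -/

open Module
open scoped InnerProductSpace

/-! ### Maximal determinants and Carathéodory's theorem -/

/-- A compact spanning set contains a basis in which all its points have coordinates of absolute
value at most one. -/
theorem IsCompact.exists_basis_abs_repr_le_one {V : Type*} [NormedAddCommGroup V] [NormedSpace ℝ V]
    [FiniteDimensional ℝ V] {m : ℕ} (hm : finrank ℝ V = m) {S : Set V} (hS : IsCompact S)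
    (hspan : Submodule.span ℝ S = ⊤) :
    ∃ b : Basis (Fin m) ℝ V, (∀ i, b i ∈ S) ∧ ∀ x ∈ S, ∀ i, |b.repr x i| ≤ 1 := by
  obtain ⟨c, hcS, hcspan, hcind⟩ := exists_linearIndependent ℝ S
  have hctop : (⊤ : Submodule ℝ V) ≤ Submodule.span ℝ (Set.range ((↑) : c → V)) := by
    rw [Subtype.range_coe, hcspan, hspan]
  let b₀ : Basis c ℝ V := Basis.mk hcind hctop
  have : Fintype c := FiniteDimensional.fintypeBasisIndex b₀
  have hcard : Fintype.card c = m := by rw [← hm, finrank_eq_card_basis b₀]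
  let e : Basis (Fin m) ℝ V := b₀.reindex (Fintype.equivFinOfCardEq hcard)
  have heS : ∀ i, e i ∈ S := fun i => by
    simp only [e, b₀, Basis.reindex_apply, Basis.mk_apply]
    exact hcS (Subtype.coe_prop _)
  have hcont : Continuous fun v : Fin m → V => |e.det v| := by
    have : Continuous fun v : Fin m → V => e.det v := by
      simp only [Basis.det_apply]
      refine Continuous.matrix_det ?_
      refine continuous_matrix fun i j => ?_
      simp only [Basis.toMatrix_apply]
      exact (LinearMap.continuous_of_finiteDimensional (e.coord i)).comp (continuous_apply j)
    exact this.abs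
  have hcpt : IsCompact (Set.univ.pi fun _ : Fin m => S) := isCompact_univ_pi fun _ => hS
  obtain ⟨v, hvS, hvmax⟩ := hcpt.exists_isMaxOn ⟨e, fun i _ => heS i⟩ hcont.continuousOn
  have hv1 : 1 ≤ |e.det v| := by
    have : |e.det e| ≤ |e.det v| := hvmax fun i _ => heS i
    rwa [e.det_self, abs_one] at this
  have hdet : e.det v ≠ 0 := fun h => by rw [h] at hv1; norm_num at hv1
  obtain ⟨hli, hsp⟩ := e.is_basis_iff_det.2 hdet.isUnit
  refine ⟨Basis.mk hli hsp.ge, fun i => by simpa using hvS i trivial, fun x hx i => ?_⟩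
  -- Cramer's rule: replacing `v i` by `x` multiplies the determinant by the `i`-th coordinate of
  -- `x`, so maximality bounds that coordinate.
  have h := congrArg (fun f => f x) (e.det_smul_mk_coord_eq_det_update hli hsp.ge i)
  simp only [LinearMap.smul_apply, Basis.coord_apply, smul_eq_mul] at h
  have h2 : |e.det (Function.update v i x)| ≤ |e.det v| := by
    refine hvmax (fun j _ => ?_)
    rcases eq_or_ne j i with rfl | hj
    · simpa using hx
    · simpa [hj] using hvS j trivial
  have h3 : |e.det v| * |(Basis.mk hli hsp.ge).repr x i| ≤ |e.det v| * 1 := by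
    rw [← abs_mul, h, mul_one]
    simpa [MultilinearMap.toLinearMap] using h2
  exact le_of_mul_le_mul_left h3 (by positivity)

/-- A point of a convex hull is a subconvex combination of linearly independent points. -/
theorem exists_linearIndepOn_of_mem_convexHull {V : Type*} [AddCommGroup V] [Module ℝ V]
    {X : Set V} {y : V} (hy : y ∈ convexHull ℝ X) :
    ∃ (s : Finset V) (w : V → ℝ), (s : Set V) ⊆ X ∧ LinearIndepOn ℝ id (s : Set V) ∧
      (∀ x ∈ s, 0 ≤ w x) ∧ ∑ x ∈ s, w x ≤ 1 ∧ ∑ x ∈ s, w x • x = y := by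
  classical
  let P : ℕ → Prop := fun k => ∃ (s : Finset V) (w : V → ℝ), (s : Set V) ⊆ X ∧ s.card = k ∧
    (∀ x ∈ s, 0 ≤ w x) ∧ ∑ x ∈ s, w x ≤ 1 ∧ ∑ x ∈ s, w x • x = y
  have hP : ∃ k, P k := by
    rw [convexHull_eq_union_convexHull_finite_subsets] at hy
    simp only [Set.mem_iUnion] at hy
    obtain ⟨s, hs, hy⟩ := hy
    rw [Finset.mem_convexHull'] at hy
    obtain ⟨w, hw, hw1, hwy⟩ := hy
    exact ⟨_, s, w, hs, rfl, hw, hw1.le, hwy⟩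
  obtain ⟨s, w, hsX, hcard, hw, hw1, hwy⟩ := Nat.find_spec hP
  refine ⟨s, w, hsX, ?_, hw, hw1, hwy⟩
  by_contra hdep
  rw [linearIndepOn_finset_iff] at hdep
  push Not at hdep
  -- Because the total weight may drop, only the sign of `∑ g` matters. A linear relation therefore
  -- suffices where the usual argument needs an affine one, which saves one point.
  have key : ∃ g : V → ℝ, ∑ x ∈ s, g x • x = 0 ∧ 0 ≤ ∑ x ∈ s, g x ∧ ∃ x ∈ s, g x ≠ 0 := by
    obtain ⟨g, hg, hne⟩ := hdep
    rcases le_total 0 (∑ x ∈ s, g x) with h | h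
    · exact ⟨g, hg, h, hne⟩
    · obtain ⟨x, hx, hx0⟩ := hne
      exact ⟨fun x => -g x, by simpa using hg, by simpa using h, x, hx, by simpa using hx0⟩
  obtain ⟨g, hg, hgsum, x₁, hx₁, hne⟩ := key
  have hpos : ∃ x ∈ s, 0 < g x := by
    by_contra! hle
    have h0 := (Finset.sum_eq_zero_iff_of_nonpos hle).1 (le_antisymm (Finset.sum_nonpos hle) hgsum)
    exact hne (h0 x₁ hx₁)
  have hfilter : (s.filter fun x => 0 < g x).Nonempty := by
    obtain ⟨x, hx, hx0⟩ := hpos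
    exact ⟨x, by simp [hx, hx0]⟩
  obtain ⟨x₀, hx₀, hmin⟩ := Finset.exists_min_image _ (fun x => w x / g x) hfilter
  simp only [Finset.mem_filter] at hx₀ hmin
  obtain ⟨hx₀s, hgx₀⟩ := hx₀
  have ht : 0 ≤ w x₀ / g x₀ := div_nonneg (hw _ hx₀s) hgx₀.le
  set t := w x₀ / g x₀ with ht_def
  have hzero : w x₀ - t * g x₀ = 0 := by rw [ht_def]; field_simp; ring
  refine Nat.find_min hP (m := (s.erase x₀).card) ?_
    ⟨s.erase x₀, fun x => w x - t * g x, ?_, rfl, ?_, ?_, ?_⟩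
  · rw [← hcard]; exact Finset.card_erase_lt_of_mem hx₀s
  · exact (Finset.coe_subset.2 (Finset.erase_subset _ _)).trans hsX
  · intro x hx
    have hxs := Finset.mem_of_mem_erase hx
    rcases lt_or_ge 0 (g x) with h | h
    · have := hmin x ⟨hxs, h⟩
      rw [le_div_iff₀ h] at this
      linarith
    · have := hw x hxs
      nlinarith
  · rw [Finset.sum_erase (f := fun x => w x - t * g x) _ hzero, Finset.sum_sub_distrib, ← Finset.mul_sum]
    nlinarith
  · rw [Finset.sum_erase (f := fun x => (w x - t * g x) • x) _ (by simp only [hzero, zero_smul])]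
    simp only [sub_smul, Finset.sum_sub_distrib, mul_smul, ← Finset.smul_sum, hwy, hg]
    simp

/-- A point in the closed convex hull of a compact set in dimension `m` is a subconvex combination
of `m` of its points. -/
theorem IsCompact.exists_fin_of_mem_closure_convexHull {V : Type*} [NormedAddCommGroup V]
    [NormedSpace ℝ V] [FiniteDimensional ℝ V] {m : ℕ} (hm : finrank ℝ V = m) {X : Set V}
    (hX : IsCompact X) {y : V} (hy : y ∈ closure (convexHull ℝ X)) :
    ∃ (w : Fin m → ℝ) (x : Fin m → V), (∀ i, x i ∈ X) ∧ (∀ i, 0 ≤ w i) ∧ ∑ i, w i ≤ 1 ∧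
      ∑ i, w i • x i = y := by
  classical
  let W : Set (Fin m → ℝ) := (Set.univ.pi fun _ => Set.Icc 0 1) ∩ {w | ∑ i, w i ≤ 1}
  have hW : IsCompact W := (isCompact_univ_pi fun _ => isCompact_Icc).inter_right
    (isClosed_le (by fun_prop) continuous_const)
  let C : Set V := (fun p : (Fin m → ℝ) × (Fin m → V) => ∑ i, p.1 i • p.2 i) ''
    (W ×ˢ Set.univ.pi fun _ => X)
  have hC : IsCompact C := (hW.prod (isCompact_univ_pi fun _ => hX)).image (by fun_prop)
  have hsub : convexHull ℝ X ⊆ C := by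
    intro y hy
    obtain ⟨x₀, hx₀⟩ : X.Nonempty := convexHull_nonempty_iff.1 ⟨y, hy⟩
    obtain ⟨s, w, hsX, hli, hw, hw1, hwy⟩ := exists_linearIndepOn_of_mem_convexHull hy
    have hcard : Fintype.card s ≤ Fintype.card (Fin m) := by
      rw [Fintype.card_fin, ← hm]
      exact LinearIndependent.fintype_card_le_finrank (R := ℝ) hli
    obtain ⟨e⟩ := Function.Embedding.nonempty_of_card_le hcard
    let w' : Fin m → ℝ := Function.extend e (fun x : s => w x) 0
    let x' : Fin m → V := Function.extend e (fun x : s => (x : V)) fun _ => x₀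
    have hw' : ∀ a, w' (e a) = w a := fun a => e.injective.extend_apply _ _ a
    have hx' : ∀ a, x' (e a) = a := fun a => e.injective.extend_apply _ _ a
    have hw0 : ∀ i, i ∉ Set.range e → w' i = 0 := fun i hi =>
      Function.extend_apply' _ _ i hi
    have hsum : ∑ i, w' i = ∑ x ∈ s, w x := by
      rw [← Finset.sum_coe_sort s]
      exact (Fintype.sum_of_injective e e.injective _ _ hw0 fun a => (hw' a).symm).symm
    have hnn : ∀ i, 0 ≤ w' i := fun i => by
      by_cases hi : i ∈ Set.range e
      · obtain ⟨a, rfl⟩ := hi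
        rw [hw']; exact hw a a.2
      · rw [hw0 i hi]
    have hsum1 : ∑ i, w' i ≤ 1 := hsum.le.trans hw1
    refine ⟨(w', x'), ⟨⟨fun i _ => ⟨hnn i, ?_⟩, hsum1⟩, fun i _ => ?_⟩, ?_⟩
    · exact (Finset.single_le_sum (fun j _ => hnn j) (Finset.mem_univ i)).trans hsum1
    · by_cases hi : i ∈ Set.range e
      · obtain ⟨a, rfl⟩ := hi
        exact (hx' a).symm.subst (motive := (· ∈ X)) (hsX a.2)
      · have : x' i = x₀ := Function.extend_apply' _ _ i hi
        exact this.symm.subst (motive := (· ∈ X)) hx₀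
    · rw [← hwy, ← Finset.sum_coe_sort s]
      refine (Fintype.sum_of_injective e e.injective _ _ (fun i hi => ?_) fun a => ?_).symm
      · simp [hw0 i hi]
      · simp [hw', hx']
  obtain ⟨⟨w, x⟩, ⟨⟨hw, hw1⟩, hx⟩, rfl⟩ := closure_minimal hsub hC.isClosed hy
  exact ⟨w, x, fun i => hx i trivial, fun i => (hw i trivial).1, hw1, rfl⟩

/-! ### An approximate centre of symmetry -/

theorem span_one_prod_eq_top {E : Type*} [NormedAddCommGroup E] [NormedSpace ℝ E] {K : Set E}
    (hint : (interior K).Nonempty) :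
    Submodule.span ℝ ((fun k : E => ((1 : ℝ), k)) '' K) = ⊤ := by
  obtain ⟨x, hx⟩ := hint
  set W := Submodule.span ℝ ((fun k : E => ((1 : ℝ), k)) '' K)
  have hmem : ∀ k ∈ K, ((1 : ℝ), k) ∈ W := fun k hk => Submodule.subset_span ⟨k, hk, rfl⟩
  have h0 : ∀ e : E, ((0 : ℝ), e) ∈ W := by
    intro e
    have hc : Continuous fun t : ℝ => x + t • e := by fun_prop
    have hev : ∀ᶠ t in nhds (0 : ℝ), x + t • e ∈ K :=
      hc.continuousAt.eventually_mem (by simpa using mem_interior_iff_mem_nhds.1 hx)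
    obtain ⟨t, ht, htpos⟩ := ((hev.filter_mono nhdsWithin_le_nhds).and
      (self_mem_nhdsWithin (s := Set.Ioi (0 : ℝ)))).exists
    have := W.smul_mem t⁻¹ (W.sub_mem (hmem _ ht) (hmem _ (interior_subset hx)))
    simpa [smul_smul, inv_mul_cancel₀ (ne_of_gt htpos)] using this
  refine (Submodule.eq_top_iff').2 fun ⟨a, e⟩ => ?_
  have := W.add_mem (W.smul_mem a (hmem _ (interior_subset hx))) (h0 (e - a • x))
  simpa using this

/-- A convex body in dimension `d` has an interior point `z` with `K - z ⊆ -d (K - z)`. -/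
theorem Convex.exists_sub_eq_neg_smul_sub {E : Type*} [NormedAddCommGroup E] [NormedSpace ℝ E]
    [FiniteDimensional ℝ E] {d : ℕ} (hd : finrank ℝ E = d) (hd0 : 0 < d) {K : Set E}
    (hconv : Convex ℝ K) (hK : IsCompact K) (hint : (interior K).Nonempty) :
    ∃ z ∈ interior K, ∀ k ∈ K, ∃ k' ∈ K, k - z = -(d : ℝ) • (k' - z) := by
  have hdpos : (0 : ℝ) < d := by exact_mod_cast hd0
  have hrank : finrank ℝ (ℝ × E) = d + 1 := by rw [finrank_prod, finrank_self, hd, add_comm]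
  -- Lifting to height one turns barycentric coordinates into linear ones.
  obtain ⟨b, hb, hcoord⟩ := (hK.image (f := fun k : E => ((1 : ℝ), k))
    (by fun_prop)).exists_basis_abs_repr_le_one hrank (span_one_prod_eq_top hint)
  choose p hpK hp using hb
  set z : E := ((d : ℝ) + 1)⁻¹ • ∑ i, p i with hz
  have hsum : ∑ i, p i = ((d : ℝ) + 1) • z := by
    rw [hz, smul_smul, mul_inv_cancel₀ (by positivity), one_smul]
  have key : ∀ k ∈ K, ∃ k' ∈ K, k - z = -(d : ℝ) • (k' - z) := by
    intro k hk
    set β := b.repr ((1 : ℝ), k)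
    have hβ : ∀ i, |β i| ≤ 1 := hcoord _ ⟨k, hk, rfl⟩
    have hrepr : ∑ i, β i • b i = ((1 : ℝ), k) := b.sum_repr _
    have h1 : ∑ i, β i = 1 := by
      have := congrArg Prod.fst hrepr
      simpa [← hp, Prod.fst_sum] using this
    have h2 : ∑ i, β i • p i = k := by
      have := congrArg Prod.snd hrepr
      simpa [← hp, Prod.snd_sum] using this
    -- The `d + 1` weights are nonnegative as `β i ≤ 1`, and sum to `(d + 1 - 1) / d = 1`.
    refine ⟨∑ i, ((1 - β i) / d) • p i, hconv.sum_mem (fun i _ => ?_) ?_ fun i _ => hpK i, ?_⟩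
    · exact div_nonneg (by linarith [(abs_le.1 (hβ i)).2]) hdpos.le
    · rw [← Finset.sum_div, Finset.sum_sub_distrib, h1]
      simp [hdpos.ne']
    · have h3 : (d : ℝ) • ∑ i, ((1 - β i) / d) • p i = ((d : ℝ) + 1) • z - k := by
        rw [Finset.smul_sum, ← hsum, ← h2, ← Finset.sum_sub_distrib]
        refine Finset.sum_congr rfl fun i _ => ?_
        rw [smul_smul, mul_div_cancel₀ _ hdpos.ne', sub_smul, one_smul]
      rw [smul_sub, neg_smul, h3]
      module
  refine ⟨z, ?_, key⟩
  obtain ⟨x, hx⟩ := hint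
  obtain ⟨k', hk', hxk⟩ := key x (interior_subset hx)
  have hzx : z = ((d : ℝ) + 1)⁻¹ • x + (d / ((d : ℝ) + 1)) • k' := by
    have h4 : x + (d : ℝ) • k' = ((d : ℝ) + 1) • z := by
      rw [sub_eq_iff_eq_add.1 hxk]; module
    rw [div_eq_inv_mul, mul_smul, ← smul_add, h4, smul_smul, inv_mul_cancel₀ (by positivity),
      one_smul]
  rw [hzx]
  exact hconv.combo_interior_self_mem_interior hx hk' (by positivity) (by positivity)
    (by field_simp; ring)

/-! ### Polarity and the selection of `2d` sets -/

/-- The one-sided polar of a set. -/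
def oneSidedPolar {E : Type*} [NormedAddCommGroup E] [InnerProductSpace ℝ E] (A : Set E) : Set E :=
  {q | ∀ k ∈ A, ⟪q, k⟫_ℝ ≤ 1}

section Polar

variable {E : Type*} [NormedAddCommGroup E] [InnerProductSpace ℝ E]

theorem zero_mem_oneSidedPolar (A : Set E) : (0 : E) ∈ oneSidedPolar A := fun k _ => by simp

theorem isClosed_oneSidedPolar (A : Set E) : IsClosed (oneSidedPolar A) := by
  have : oneSidedPolar A = ⋂ k ∈ A, {q | ⟪q, k⟫_ℝ ≤ 1} := by ext; simp [oneSidedPolar]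
  rw [this]
  exact isClosed_biInter fun k _ => isClosed_le (by fun_prop) continuous_const

theorem isBounded_oneSidedPolar {A : Set E} (hA : A ∈ nhds (0 : E)) :
    Bornology.IsBounded (oneSidedPolar A) := by
  obtain ⟨r, hr, hball⟩ := Metric.nhds_basis_closedBall.mem_iff.1 hA
  refine isBounded_iff_forall_norm_le.2 ⟨r⁻¹, fun q hq => ?_⟩
  rcases eq_or_ne q 0 with rfl | hq0
  · simpa using hr.le
  have hqn : 0 < ‖q‖ := norm_pos_iff.2 hq0
  have h := hq ((r / ‖q‖) • q) (hball (by
    rw [mem_closedBall_zero_iff, norm_smul, Real.norm_of_nonneg (by positivity),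
      div_mul_cancel₀ _ hqn.ne']))
  rw [real_inner_smul_right, real_inner_self_eq_norm_sq] at h
  rw [← one_div, le_div_iff₀ hr]
  calc ‖q‖ * r = r / ‖q‖ * ‖q‖ ^ 2 := by field_simp
    _ ≤ 1 := h

/-- The bipolar theorem for closed convex sets containing the origin. -/
theorem mem_of_forall_oneSidedPolar [CompleteSpace E] {A : Set E} (hc : IsClosed A)
    (hconv : Convex ℝ A) (h0 : (0 : E) ∈ A) {p : E}
    (hp : ∀ q ∈ oneSidedPolar A, ⟪q, p⟫_ℝ ≤ 1) : p ∈ A := by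
  by_contra hpA
  obtain ⟨f, u, hlt, hgt⟩ := geometric_hahn_banach_closed_point hconv hc hpA
  have hu : 0 < u := by simpa using hlt 0 h0
  have hf : ∀ x, ⟪(InnerProductSpace.toDual ℝ E).symm f, x⟫_ℝ = f x := fun x =>
    InnerProductSpace.toDual_symm_apply
  have h := hp (u⁻¹ • (InnerProductSpace.toDual ℝ E).symm f) fun k hk => by
    rw [real_inner_smul_left, hf, inv_mul_le_one₀ hu]
    exact (hlt k hk).le
  rw [real_inner_smul_left, hf, inv_mul_le_one₀ hu] at h
  exact absurd h (not_le.2 hgt)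

/-- The polar of a finite intersection lies in the closed convex hull of the union of the polars. -/
theorem oneSidedPolar_iInter_subset [CompleteSpace E] {ι : Type*} [Nonempty ι] {A : ι → Set E}
    (hc : ∀ i, IsClosed (A i)) (hconv : ∀ i, Convex ℝ (A i)) (h0 : ∀ i, (0 : E) ∈ A i) :
    oneSidedPolar (⋂ i, A i) ⊆ closure (convexHull ℝ (⋃ i, oneSidedPolar (A i))) := by
  intro y hy
  by_contra hyX
  obtain ⟨f, u, hlt, hgt⟩ := geometric_hahn_banach_closed_point (convex_convexHull ℝ _).closure
    isClosed_closure hyX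
  have hmem : ∀ i, ∀ q ∈ oneSidedPolar (A i), f q < u := fun i q hq =>
    hlt q (subset_closure (subset_convexHull ℝ _ (Set.mem_iUnion.2 ⟨i, hq⟩)))
  have hu : 0 < u := by
    simpa using hmem (Classical.arbitrary ι) 0 (zero_mem_oneSidedPolar _)
  have hf : ∀ x, ⟪x, (InnerProductSpace.toDual ℝ E).symm f⟫_ℝ = f x := fun x => by
    rw [real_inner_comm]; exact InnerProductSpace.toDual_symm_apply
  have h := hy (u⁻¹ • (InnerProductSpace.toDual ℝ E).symm f) (Set.mem_iInter.2 fun i =>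
    mem_of_forall_oneSidedPolar (hc i) (hconv i) (h0 i) fun q hq => by
      rw [real_inner_smul_right, hf, inv_mul_le_one₀ hu]
      exact (hmem i q hq).le)
  rw [real_inner_smul_right, hf, inv_mul_le_one₀ hu] at h
  exact absurd h (not_le.2 hgt)

/-- A nonzero vector orthogonal to all the polars would span a line contained in every `A i`, by
bipolarity. -/
theorem span_iUnion_oneSidedPolar [FiniteDimensional ℝ E] {ι : Type*} {A : ι → Set E}
    (hc : ∀ i, IsClosed (A i)) (hconv : ∀ i, Convex ℝ (A i)) (h0 : ∀ i, (0 : E) ∈ A i)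
    (hbdd : Bornology.IsBounded (⋂ i, A i)) :
    Submodule.span ℝ (⋃ i, oneSidedPolar (A i)) = ⊤ := by
  rw [← Submodule.orthogonal_eq_bot_iff, Submodule.eq_bot_iff]
  intro u hu
  by_contra hu0
  have horth : ∀ i, ∀ q ∈ oneSidedPolar (A i), ⟪q, u⟫_ℝ = 0 := fun i q hq =>
    (Submodule.mem_orthogonal _ _).1 hu q (Submodule.subset_span (Set.mem_iUnion.2 ⟨i, hq⟩))
  have hmem : ∀ t : ℝ, t • u ∈ ⋂ i, A i := fun t => Set.mem_iInter.2 fun i =>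
    mem_of_forall_oneSidedPolar (hc i) (hconv i) (h0 i) fun q hq => by
      rw [real_inner_smul_right, horth i q hq]; simp
  obtain ⟨R, hR⟩ := isBounded_iff_forall_norm_le.1 hbdd
  have hun : 0 < ‖u‖ := norm_pos_iff.2 hu0
  have h := hR _ (hmem ((|R| + 1) / ‖u‖))
  rw [norm_smul, Real.norm_of_nonneg (by positivity), div_mul_cancel₀ _ hun.ne'] at h
  linarith [le_abs_self R]

/-- If the intersection `A` of finitely many closed convex sets in dimension `d` is a neighbourhood
of the origin with `A ⊆ -lam A`, then at most `2 d` of the sets have their intersection contained in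
`-d (lam + 2) A`. -/
theorem exists_finset_biInter_subset_neg_smul [FiniteDimensional ℝ E] {d : ℕ}
    (hd : finrank ℝ E = d) (hd0 : 0 < d) {ι : Type*} [Finite ι] {A : ι → Set E}
    (hc : ∀ i, IsClosed (A i)) (hconv : ∀ i, Convex ℝ (A i)) (h0 : (⋂ i, A i) ∈ nhds (0 : E))
    (hbdd : Bornology.IsBounded (⋂ i, A i)) {lam : ℝ} (hlam : 0 < lam)
    (hsymm : ∀ k ∈ ⋂ i, A i, ∃ k' ∈ ⋂ i, A i, k = -lam • k') {c : ℝ} (hcd : d * (lam + 2) ≤ c) :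
    ∃ μ : Finset ι, μ.card ≤ 2 * d ∧ ∀ p ∈ ⋂ i ∈ μ, A i, ∃ k ∈ ⋂ i, A i, p = -c • k := by
  classical
  have hdpos : (0 : ℝ) < d := by exact_mod_cast hd0
  have hcpos : 0 < c := lt_of_lt_of_le (by positivity) hcd
  have hA0 : ∀ i, A i ∈ nhds (0 : E) := fun i => Filter.mem_of_superset h0 (Set.iInter_subset _ i)
  have h0A : ∀ i, (0 : E) ∈ A i := fun i => mem_of_mem_nhds (hA0 i)
  have hX : IsCompact (⋃ i, oneSidedPolar (A i)) := isCompact_iUnion fun i =>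
    Metric.isCompact_of_isClosed_isBounded (isClosed_oneSidedPolar _)
      (isBounded_oneSidedPolar (hA0 i))
  obtain ⟨b, hbX, hb⟩ := hX.exists_basis_abs_repr_le_one hd
    (span_iUnion_oneSidedPolar hc hconv h0A hbdd)
  choose i hi using fun k => Set.mem_iUnion.1 (hbX k)
  have : Nonempty ι := ⟨i ⟨0, hd0⟩⟩
  have hy : -(d * lam)⁻¹ • ∑ k, b k ∈ oneSidedPolar (⋂ i, A i) := by
    intro k hk
    obtain ⟨k', hk', rfl⟩ := hsymm k hk
    have hle : ⟪∑ k, b k, k'⟫_ℝ ≤ d := by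
      rw [sum_inner]
      refine (Finset.sum_le_card_nsmul _ _ 1 fun j _ => ?_).trans (by simp)
      exact hi j k' (Set.mem_iInter.1 hk' _)
    rw [real_inner_smul_left, real_inner_smul_right]
    calc -(d * lam)⁻¹ * (-lam * ⟪∑ k, b k, k'⟫_ℝ) = ⟪∑ k, b k, k'⟫_ℝ / d := by field_simp
      _ ≤ 1 := by rwa [div_le_one hdpos]
  obtain ⟨w, x, hxX, hw, hw1, hwy⟩ := hX.exists_fin_of_mem_closure_convexHull hd
    (oneSidedPolar_iInter_subset hc hconv h0A hy)
  choose j hj using fun k => Set.mem_iUnion.1 (hxX k)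
  refine ⟨Finset.univ.image i ∪ Finset.univ.image j, ?_, fun p hp => ?_⟩
  · refine (Finset.card_union_le _ _).trans ?_
    have h1 := Finset.card_image_le (s := Finset.univ) (f := i)
    have h2 := Finset.card_image_le (s := Finset.univ) (f := j)
    rw [Finset.card_univ, Fintype.card_fin] at h1 h2
    omega
  have hpi : ∀ k, ⟪b k, p⟫_ℝ ≤ 1 := fun k => hi k p (Set.mem_iInter₂.1 hp _ (by simp))
  have hpj : ∀ k, ⟪x k, p⟫_ℝ ≤ 1 := fun k => hj k p (Set.mem_iInter₂.1 hp _ (by simp))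
  have hpy : -⟪∑ k, b k, p⟫_ℝ ≤ d * lam := by
    have h : ⟪-(d * lam)⁻¹ • ∑ k, b k, p⟫_ℝ ≤ 1 := by
      rw [← hwy, sum_inner]
      refine (Finset.sum_le_sum fun k _ => ?_).trans hw1
      rw [real_inner_smul_left]
      exact mul_le_of_le_one_right (hw k) (hpj k)
    rw [real_inner_smul_left, neg_mul, ← mul_neg, inv_mul_le_one₀ (by positivity)] at h
    exact h
  refine ⟨-c⁻¹ • p, Set.mem_iInter.2 fun l => ?_, by
    rw [smul_smul, neg_mul_neg, mul_inv_cancel₀ hcpos.ne', one_smul]⟩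
  refine mem_of_forall_oneSidedPolar (hc l) (hconv l) (h0A l) fun q hq => ?_
  have hβ := hb q (Set.mem_iUnion.2 ⟨l, hq⟩)
  have hq' : ⟪q, p⟫_ℝ = ∑ k, b.repr q k * ⟪b k, p⟫_ℝ := by
    conv_lhs => rw [← b.sum_repr q]
    simp only [sum_inner, real_inner_smul_left]
  -- Subtracting `q` from `∑ b k` leaves coefficients in `[0, 2]`, so the upper bounds on `⟪b k, p⟫`
  -- suffice.
  have hsum : ∑ k, (1 - b.repr q k) * ⟪b k, p⟫_ℝ ≤ d * 2 := by
    refine (Finset.sum_le_card_nsmul _ _ 2 fun k _ => ?_).trans (by simp)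
    have := abs_le.1 (hβ k)
    nlinarith [hpi k]
  have hexp : ∑ k, (1 - b.repr q k) * ⟪b k, p⟫_ℝ = ⟪∑ k, b k, p⟫_ℝ - ⟪q, p⟫_ℝ := by
    rw [hq', sum_inner, ← Finset.sum_sub_distrib]
    exact Finset.sum_congr rfl fun k _ => by ring
  rw [real_inner_smul_right, neg_mul, ← mul_neg, inv_mul_le_one₀ hcpos]
  linarith

end Polar

/-! ### Volume, diameter and conclusion -/

/-- Volume and diameter of a set contained in the homothetic image of `K` of ratio `-c`. -/
theorem volume_ediam_le_of_subset_homothety {d : ℕ} {K L : Set (EuclideanSpace ℝ (Fin d))}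
    {z : EuclideanSpace ℝ (Fin d)} {c : NNReal}
    (h : L ⊆ AffineMap.homothety z (-(c : ℝ)) '' K) :
    MeasureTheory.volume L ≤ (c : ENNReal) ^ d * MeasureTheory.volume K ∧
      Metric.ediam L ≤ c * Metric.ediam K := by
  constructor
  · refine (MeasureTheory.measure_mono h).trans ?_
    rw [MeasureTheory.Measure.addHaar_image_homothety, finrank_euclideanSpace_fin, abs_pow, abs_neg,
      NNReal.abs_eq, ENNReal.ofReal_pow c.coe_nonneg, ENNReal.ofReal_coe_nnreal]
  · refine (Metric.ediam_mono h).trans (LipschitzWith.ediam_image_le ?_ K)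
    refine LipschitzWith.of_dist_le_mul fun x y => ?_
    have : AffineMap.homothety z (-(c : ℝ)) x - AffineMap.homothety z (-(c : ℝ)) y =
        -((c : ℝ) • (x - y)) := by
      simp only [AffineMap.homothety_apply, vsub_eq_sub, vadd_eq_add]
      module
    rw [dist_eq_norm, this, norm_neg, norm_smul, NNReal.norm_eq, dist_eq_norm]

theorem mainTheorem1 (d n : ℕ) (K : Fin n → Set (EuclideanSpace ℝ (Fin d)))
    (hclosed : ∀ i, IsClosed (K i)) (hconvex : ∀ i, Convex ℝ (K i))
    (hbody : IsConvexBodyWithInterior (⋂ i, K i)) :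
    ∃ μ : Finset (Fin n), μ.card ≤ 2 * d ∧
      MeasureTheory.volume (⋂ i ∈ μ, K i) ≤
        (2 * (d : ENNReal)) ^ (3 * d) * MeasureTheory.volume (⋂ i, K i) ∧
      Metric.ediam (⋂ i ∈ μ, K i) ≤
        (2 * (d : ENNReal)) ^ 3 * Metric.ediam (⋂ i, K i) := by
  obtain ⟨hconv, hcpt, hint⟩ := hbody
  rcases Nat.eq_zero_or_pos d with rfl | hd
  -- In dimension zero the space is a single point, and `μ = ∅` works with `0 ^ 0 = 1`.
  · have huniv : ⋂ i, K i = Set.univ := (hint.mono interior_subset).eq_univ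
    refine ⟨∅, by simp, ?_, ?_⟩
    · rw [huniv]; simp
    · rw [Metric.ediam_subsingleton (Set.subsingleton_of_subsingleton)]; simp
  obtain ⟨z, hz, hsymm⟩ := hconv.exists_sub_eq_neg_smul_sub finrank_euclideanSpace_fin hd hcpt hint
  have hdpos : (1 : ℝ) ≤ d := by exact_mod_cast hd
  have htrans : ⋂ i, (fun x => x + z) ⁻¹' K i = (fun x => x + z) ⁻¹' ⋂ i, K i :=
    Set.preimage_iInter.symm
  obtain ⟨μ, hμ, hsub⟩ := exists_finset_biInter_subset_neg_smul
    (A := fun i => (fun x => x + z) ⁻¹' K i) (lam := d) (c := (2 * d) ^ 3)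
    finrank_euclideanSpace_fin hd (fun i => (hclosed i).preimage (by fun_prop))
    (fun i => (hconvex i).translate_preimage_left z)
    (by
      rw [htrans]
      exact (by fun_prop : Continuous fun x => x + z).continuousAt.preimage_mem_nhds
        (by simpa using mem_interior_iff_mem_nhds.1 hz))
    (by
      rw [htrans]
      exact ((Homeomorph.addRight z).isCompact_preimage.2 hcpt).isBounded)
    (by positivity)
    (by
      rw [htrans]
      intro k hk
      obtain ⟨k', hk', h⟩ := hsymm _ hk
      exact ⟨k' - z, by simpa using hk', by simpa using h⟩)
    (by nlinarith [mul_le_mul hdpos hdpos (by norm_num) (by positivity)])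
  have hincl : ⋂ i ∈ μ, K i ⊆ AffineMap.homothety z (-(((2 * d) ^ 3 : NNReal) : ℝ)) '' ⋂ i, K i := by
    intro p hp
    obtain ⟨k, hk, hpk⟩ := hsub (p - z) (by simpa using hp)
    rw [htrans] at hk
    refine ⟨k + z, hk, ?_⟩
    rw [AffineMap.homothety_apply, vsub_eq_sub, vadd_eq_add, add_sub_cancel_right]
    push_cast
    rw [← hpk, sub_add_cancel]
  obtain ⟨hvol, hdiam⟩ := volume_ediam_le_of_subset_homothety hincl
  refine ⟨μ, hμ, ?_, ?_⟩
  · simpa [pow_mul] using hvol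
  · simpa using hdiam
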